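/- Conventions. For a unital $*$-algebra $C$ let $S(C)$ be the set of states on $C$, i.e. of positive unital linear functionals. Let $M_n=M_n(\mathbb{C})$ with matrix units $E_{ij}$. The Brown algebra $\mathcal{U}(n)$ is the universal unital C*-algebra generated by elements $u_{ij}$ ($1\le i,j\le n$) subject to the relations $\sum_k u_{ik}u_{lk}^*=\delta_{il}1$ and $\sum_i u_{ik}^*u_{il}=\delta_{kl}1$. By $*_{x=1}^m\mathcal{U}^x(n)$ we denote the full free product (with units identified) of $m$ copies of $\mathcal{U}(n)$, with $u^x_{ij}$ the generators of the $x$-th copy, and $\otimes_{\max}$ is the maximal tensor product of unital C*-algebras. A family $\{\Lambda_{xy}\}_{x,y=1}^m$ of maps $\Lambda_{xy}:S(M_n\otimes M_n)\to S(M_n\otimes M_n)$ is a generalized unitary induced channel in the quantum commuting model, written $\{\Lambda_{xy}\}\in\mathcal{L}_{qc}(m,n)$, if there are a Hilbert space $H$, a state $\phi\in S(B(H))$ and unitaries $U^x,V^y\in M_n(B(H))$ ($x,y=1,\dots,m$) such that, in $M_n\otimes B(H)\otimes M_n$, with $U^x\in M_n\otimes B(H)$ acting on the first two factors and $V^y\in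 B(H)\otimes M_n$ on the last two, for all $x,y$ one has $(U^x\otimes 1)(1\otimes V^y)=(1\otimes V^y)(U^x\otimes 1)$ and $$\Lambda_{xy}(\varphi)(g\otimes h)=(\varphi\otimes\phi)\big((U^x\otimes 1)(1\otimes V^y)(g\otimes 1\otimes h)(1\otimes (V^y)^*)((U^x)^*\otimes 1)\big)$$ for all $\varphi\in S(M_n\otimes M_n)$ and $g,h\in M_n$. Here $\varphi\otimes\phi$ is the linear functional with $(\varphi\otimes\phi)(g\otimes c\otimes h)=\varphi(g\otimes h)\,\phi(c)$. Theorem. Let $m,n$ be natural numbers and let $\{\Lambda_{xy}\}_{x,y=1}^m$ be a family of maps $S(M_n\otimes M_n)\to S(M_n\otimes M_n)$. The following conditions are equivalent. 1. $\{\Lambda_{xy}\}\in\mathcal{L}_{qc}(m,n)$. 2. There are unital C*-algebras $A,B$, a state $\tilde\phi\in S(A\otimes_{\max}B)$ and unitaries $U^x=(\tilde u^x_{ij})_{i,j}\in M_n(A)$, $V^y=(\tilde v^y_{kl})_{k,l}\in M_n(B)$ ($x,y=1,\dots,m$) such that for all $x,y$, all $\varphi\in S(M_n\otimes M_n)$ and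 all $g,h\in M_n$ $$\Lambda_{xy}(\varphi)(g\otimes h)=\sum_{i,j,k,l,p,r,s,t=1}^n\varphi(E_{ij}gE_{kl}\otimes E_{pr}hE_{st})\;\tilde\phi\big(\tilde u^x_{ij}(\tilde u^x_{lk})^*\otimes\tilde v^y_{pr}(\tilde v^y_{ts})^*\big).$$ 3. There is a state $\phi\in S\big((*_{x=1}^m\mathcal{U}^x(n))\otimes_{\max}(*_{y=1}^m\mathcal{U}^y(n))\big)$ such that for all $x,y$, all $\varphi\in S(M_n\otimes M_n)$ and all $g,h\in M_n$ $$\Lambda_{xy}(\varphi)(g\otimes h)=\sum_{i,j,k,l,p,r,s,t=1}^n\varphi(E_{ij}gE_{kl}\otimes E_{pr}hE_{st})\;\phi\big(u^x_{ij}(u^x_{lk})^*\otimes v^y_{pr}(v^y_{ts})^*\big),$$ where $u^x_{ij}$ and $v^y_{kl}$ are the generators of the $x$-th copy of $\mathcal{U}(n)$ in the first free product and of the $y$-th copy of $\mathcal{U}(n)$ in the second one. -/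

import Mathlib

universe u v w

open scoped TensorProduct ComplexOrder

noncomputable section

/-! ### C*-seminorms and the associated C*-completions -/

/-- A C*-seminorm on a unital complex *-algebra. -/
structure CStarSeminorm (A : Type*) [Ring A] [StarRing A] [Algebra ℂ A] extends
    Seminorm ℂ A where
  mul_le' : ∀ a b : A, toFun (a * b) ≤ toFun a * toFun b
  star_mul_self' : ∀ a : A, toFun (star a * a) = toFun a * toFun a

namespace CStarSeminorm

section

variable {A : Type*} [Ring A] [StarRing A] [Algebra ℂ A]

instance : CoeFun (CStarSeminorm A) (fun _ => A → ℝ) := ⟨fun p => p.toSeminorm⟩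

theorem mul_le (p : CStarSeminorm A) (a b : A) : p (a * b) ≤ p a * p b := p.mul_le' a b

theorem star_mul_self (p : CStarSeminorm A) (a : A) : p (star a * a) = p a * p a :=
  p.star_mul_self' a

theorem nonneg (p : CStarSeminorm A) (a : A) : 0 ≤ p a := apply_nonneg p.toSeminorm a

theorem le_star (p : CStarSeminorm A) (a : A) : p a ≤ p (star a) := by
  have h := p.mul_le (star a) a
  rw [p.star_mul_self] at h
  rcases (p.nonneg a).eq_or_lt with h0 | h0
  · rw [← h0]; exact p.nonneg _
  · exact le_of_mul_le_mul_right h h0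

theorem star_eq (p : CStarSeminorm A) (a : A) : p (star a) = p a :=
  le_antisymm (by simpa using p.le_star (star a)) (p.le_star a)

/-- The C*-seminorm that vanishes identically. -/
def zero (A : Type*) [Ring A] [StarRing A] [Algebra ℂ A] : CStarSeminorm A where
  toSeminorm := 0
  mul_le' a b := (by simp : (0 : Seminorm ℂ A) (a * b) ≤ (0 : Seminorm ℂ A) a * (0 : Seminorm ℂ A) b)
  star_mul_self' a :=
    (by simp : (0 : Seminorm ℂ A) (star a * a) = (0 : Seminorm ℂ A) a * (0 : Seminorm ℂ A) a)

/-- The algebra `A`, regarded as a seminormed algebra by means of `p`. -/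
@[nolint unusedArguments]
def Pre (_ : CStarSeminorm A) : Type _ := A

variable (p : CStarSeminorm A)

instance : Ring p.Pre := inferInstanceAs (Ring A)
instance : StarRing p.Pre := inferInstanceAs (StarRing A)
instance : Algebra ℂ p.Pre := inferInstanceAs (Algebra ℂ A)
instance [StarModule ℂ A] : StarModule ℂ p.Pre := inferInstanceAs (StarModule ℂ A)

instance : SeminormedRing p.Pre where
  __ := (inferInstance : Ring p.Pre)
  __ := (p.toSeminorm.toAddGroupSeminorm.toSeminormedAddCommGroup : SeminormedAddCommGroup A)
  norm_mul_le := p.mul_le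

theorem pre_norm_def (a : p.Pre) : ‖a‖ = p a := rfl

instance : NormedAlgebra ℂ p.Pre where
  norm_smul_le c a := (map_smul_eq_mul p.toSeminorm c a).le

theorem pre_norm_star (a : p.Pre) : ‖star a‖ = ‖a‖ := p.star_eq a

theorem pre_star_isometry : Isometry (star : p.Pre → p.Pre) :=
  AddMonoidHomClass.isometry_of_norm (starAddEquiv : p.Pre ≃+ p.Pre) p.pre_norm_star

/-- The Hausdorff completion of `A` with respect to the C*-seminorm `p`. -/
def Completion : Type _ := UniformSpace.Completion p.Pre

instance : NormedRing p.Completion := inferInstanceAs (NormedRing (UniformSpace.Completion p.Pre))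
instance : CompleteSpace p.Completion :=
  inferInstanceAs (CompleteSpace (UniformSpace.Completion p.Pre))

instance : NormedAlgebra ℂ p.Completion where
  __ := (inferInstance : Algebra ℂ (UniformSpace.Completion p.Pre))
  norm_smul_le := norm_smul_le (α := ℂ) (β := UniformSpace.Completion p.Pre)

/-- The canonical map of `A` into its completion, as a function. -/
def embed (a : A) : p.Completion := ((show p.Pre from a : p.Pre) : UniformSpace.Completion p.Pre)

theorem norm_embed (a : A) : ‖p.embed a‖ = p a :=
  UniformSpace.Completion.norm_coe (E := p.Pre) a

theorem embed_add (a b : A) : p.embed (a + b) = p.embed a + p.embed b :=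
  UniformSpace.Completion.coe_add (α := p.Pre) a b

theorem embed_mul (a b : A) : p.embed (a * b) = p.embed a * p.embed b :=
  UniformSpace.Completion.coe_mul (α := p.Pre) a b

theorem embed_one : p.embed 1 = 1 := rfl

theorem embed_smul (c : ℂ) (a : A) : p.embed (c • a) = c • p.embed a :=
  UniformSpace.Completion.coe_smul (X := p.Pre) c a

theorem denseRange_embed : DenseRange p.embed := UniformSpace.Completion.denseRange_coe (α := p.Pre)

theorem completion_induction {P : p.Completion → Prop} (x : p.Completion)
    (hc : IsClosed {x | P x}) (h : ∀ a : A, P (p.embed a)) : P x :=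
  isClosed_property p.denseRange_embed hc h x

instance : Star p.Completion :=
  ⟨UniformSpace.Completion.map (star : p.Pre → p.Pre)⟩

theorem embed_star (a : A) : p.embed (star a) = star (p.embed a) :=
  (UniformSpace.Completion.map_coe p.pre_star_isometry.uniformContinuous a).symm

instance : ContinuousStar p.Completion := ⟨UniformSpace.Completion.continuous_map⟩

instance : StarRing p.Completion where
  star_involutive x := by
    refine p.completion_induction (P := fun x => star (star x) = x) x
      (isClosed_eq (by fun_prop) (by fun_prop)) fun a => ?_
    rw [← embed_star, ← embed_star, star_star]
  star_mul x y := by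
    refine p.completion_induction (P := fun x => star (x * y) = star y * star x) x
      (isClosed_eq (by fun_prop) (by fun_prop)) fun a => ?_
    refine p.completion_induction (P := fun y => star (p.embed a * y) = star y * star (p.embed a)) y
      (isClosed_eq (by fun_prop) (by fun_prop)) fun b => ?_
    rw [← embed_mul, ← embed_star, ← embed_star, ← embed_star, ← embed_mul, StarMul.star_mul]
  star_add x y := by
    refine p.completion_induction (P := fun x => star (x + y) = star x + star y) x
      (isClosed_eq (by fun_prop) (by fun_prop)) fun a => ?_
    refine p.completion_induction (P := fun y => star (p.embed a + y) = star (p.embed a) + star y) y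
      (isClosed_eq (by fun_prop) (by fun_prop)) fun b => ?_
    rw [← embed_add, ← embed_star, ← embed_star, ← embed_star, ← embed_add, star_add]

instance : CStarRing p.Completion where
  norm_mul_self_le x := by
    refine p.completion_induction (P := fun x => ‖x‖ * ‖x‖ ≤ ‖star x * x‖) x
      (isClosed_le (by fun_prop) (by fun_prop)) fun a => ?_
    rw [← embed_star, ← embed_mul, norm_embed, norm_embed, p.star_mul_self]

variable [StarModule ℂ A]

instance : StarModule ℂ p.Completion where
  star_smul c x := by
    refine p.completion_induction (P := fun x => star (c • x) = star c • star x) x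
      (isClosed_eq (continuous_star.comp (continuous_const_smul c))
        (continuous_star.const_smul (star c))) fun a => ?_
    rw [← embed_smul, ← embed_star, ← embed_star, ← embed_smul, StarModule.star_smul]

instance : CStarAlgebra p.Completion where

/-- The canonical unital *-homomorphism of `A` into its completion with respect to `p`. -/
def toCompletion : A →⋆ₐ[ℂ] p.Completion where
  toFun := p.embed
  map_one' := p.embed_one
  map_mul' := p.embed_mul
  map_zero' := rfl
  map_add' := p.embed_add
  commutes' c := by
    rw [Algebra.algebraMap_eq_smul_one, Algebra.algebraMap_eq_smul_one, embed_smul, embed_one]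
  map_star' := p.embed_star

theorem norm_toCompletion (a : A) : ‖p.toCompletion a‖ = p a := p.norm_embed a

end

end CStarSeminorm

/-! ### Universal C*-algebras -/

section Universal

variable {A : Type*} [Ring A] [StarRing A] [Algebra ℂ A]

/-- The values at `a` of the C*-seminorms on `A` that vanish on the set `R` of relations. -/
def cstarSeminormValues (R : Set A) (a : A) : Set ℝ :=
  {t | ∃ p : CStarSeminorm A, (∀ r ∈ R, p r = 0) ∧ t = p a}

/-- The condition under which the universal C*-algebra of `A` modulo the relations `R = 0` exists:
at every element, the C*-seminorms that vanish on `R` are bounded. -/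
class CStarBounded (R : Set A) : Prop where
  bddAbove : ∀ a : A, BddAbove (cstarSeminormValues R a)

theorem cstarSeminormValues_nonempty (R : Set A) (a : A) : (cstarSeminormValues R a).Nonempty :=
  ⟨_, CStarSeminorm.zero A, fun _ _ => rfl, rfl⟩

variable (R : Set A) [CStarBounded R]

theorem CStarSeminorm.le_sSup {R : Set A} [CStarBounded R] (p : CStarSeminorm A)
    (hp : ∀ r ∈ R, p r = 0) (a : A) : p a ≤ sSup (cstarSeminormValues R a) :=
  le_csSup (CStarBounded.bddAbove a) ⟨p, hp, rfl⟩

theorem sSup_cstarSeminormValues_nonneg (a : A) : 0 ≤ sSup (cstarSeminormValues R a) :=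
  (CStarSeminorm.zero A).le_sSup (fun _ _ => rfl) a

/-- The largest C*-seminorm on `A` that vanishes on `R`: the supremum of all of them. -/
def universalCStarSeminorm : CStarSeminorm A where
  toSeminorm := Seminorm.of (fun a => sSup (cstarSeminormValues R a))
    (fun a b => by
      refine csSup_le (cstarSeminormValues_nonempty R _) ?_
      rintro _ ⟨p, hp, rfl⟩
      exact (map_add_le_add p.toSeminorm a b).trans (add_le_add (p.le_sSup hp a) (p.le_sSup hp b)))
    (fun c a => by
      refine le_antisymm ?_ ?_
      · refine csSup_le (cstarSeminormValues_nonempty R _) ?_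
        rintro _ ⟨p, hp, rfl⟩
        rw [map_smul_eq_mul]
        exact mul_le_mul_of_nonneg_left (p.le_sSup hp a) (norm_nonneg c)
      · rcases eq_or_ne c 0 with rfl | hc
        · simpa using sSup_cstarSeminormValues_nonneg R (0 : A)
        · rw [← le_div_iff₀' (norm_pos_iff.mpr hc)]
          refine csSup_le (cstarSeminormValues_nonempty R _) ?_
          rintro _ ⟨p, hp, rfl⟩
          rw [le_div_iff₀' (norm_pos_iff.mpr hc), ← map_smul_eq_mul p.toSeminorm]
          exact p.le_sSup hp _)
  mul_le' a b := by
    refine csSup_le (cstarSeminormValues_nonempty R _) ?_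
    rintro _ ⟨p, hp, rfl⟩
    exact (p.mul_le a b).trans (mul_le_mul (p.le_sSup hp a) (p.le_sSup hp b) (p.nonneg b)
      (sSup_cstarSeminormValues_nonneg R a))
  star_mul_self' a := by
    refine le_antisymm ?_ ?_
    · refine csSup_le (cstarSeminormValues_nonempty R _) ?_
      rintro _ ⟨p, hp, rfl⟩
      rw [p.star_mul_self]
      exact mul_self_le_mul_self (p.nonneg a) (p.le_sSup hp a)
    · have h0 := sSup_cstarSeminormValues_nonneg R (star a * a)
      have h : sSup (cstarSeminormValues R a) ≤ √(sSup (cstarSeminormValues R (star a * a))) := by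
        refine csSup_le (cstarSeminormValues_nonempty R _) ?_
        rintro _ ⟨p, hp, rfl⟩
        refine Real.le_sqrt_of_sq_le ?_
        rw [sq, ← p.star_mul_self]
        exact p.le_sSup hp _
      calc _ ≤ √(sSup (cstarSeminormValues R (star a * a))) *
              √(sSup (cstarSeminormValues R (star a * a))) :=
            mul_self_le_mul_self (sSup_cstarSeminormValues_nonneg R a) h
        _ = _ := Real.mul_self_sqrt h0

variable [StarModule ℂ A]

/-- The universal C*-algebra generated by the *-algebra `A` subject to the relations `r = 0`
for `r ∈ R`. -/
abbrev UniversalCStarAlgebra : Type _ := (universalCStarSeminorm R).Completion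

/-- The canonical *-homomorphism from `A` to the universal C*-algebra. -/
abbrev UniversalCStarAlgebra.of : A →⋆ₐ[ℂ] UniversalCStarAlgebra R :=
  (universalCStarSeminorm R).toCompletion

end Universal

section Bounded

variable {A : Type*} [Ring A] [StarRing A] [Algebra ℂ A] {R : Set A}

theorem bddAbove_values_add {a b : A} (ha : BddAbove (cstarSeminormValues R a))
    (hb : BddAbove (cstarSeminormValues R b)) : BddAbove (cstarSeminormValues R (a + b)) := by
  obtain ⟨s, hs⟩ := ha
  obtain ⟨t, ht⟩ := hb
  refine ⟨s + t, ?_⟩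
  rintro _ ⟨p, hp, rfl⟩
  exact (map_add_le_add p.toSeminorm a b).trans
    (add_le_add (hs ⟨p, hp, rfl⟩) (ht ⟨p, hp, rfl⟩))

theorem bddAbove_values_mul {a b : A} (ha : BddAbove (cstarSeminormValues R a))
    (hb : BddAbove (cstarSeminormValues R b)) : BddAbove (cstarSeminormValues R (a * b)) := by
  obtain ⟨s, hs⟩ := ha
  obtain ⟨t, ht⟩ := hb
  refine ⟨s * t, ?_⟩
  rintro _ ⟨p, hp, rfl⟩
  have h1 : p a ≤ s := hs ⟨p, hp, rfl⟩
  exact (p.mul_le a b).trans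
    (mul_le_mul h1 (ht ⟨p, hp, rfl⟩) (p.nonneg b) ((p.nonneg a).trans h1))

theorem bddAbove_values_smul (c : ℂ) {a : A} (ha : BddAbove (cstarSeminormValues R a)) :
    BddAbove (cstarSeminormValues R (c • a)) := by
  obtain ⟨s, hs⟩ := ha
  refine ⟨‖c‖ * s, ?_⟩
  rintro _ ⟨p, hp, rfl⟩
  rw [map_smul_eq_mul]
  exact mul_le_mul_of_nonneg_left (hs ⟨p, hp, rfl⟩) (norm_nonneg c)

theorem bddAbove_values_star {a : A} (ha : BddAbove (cstarSeminormValues R a)) :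
    BddAbove (cstarSeminormValues R (star a)) := by
  obtain ⟨s, hs⟩ := ha
  refine ⟨s, ?_⟩
  rintro _ ⟨p, hp, rfl⟩
  rw [p.star_eq]
  exact hs ⟨p, hp, rfl⟩

theorem bddAbove_values_one : BddAbove (cstarSeminormValues R (1 : A)) := by
  refine ⟨1, ?_⟩
  rintro _ ⟨p, hp, rfl⟩
  have h := p.star_mul_self 1
  rw [star_one, one_mul] at h
  nlinarith [p.nonneg 1]

end Bounded

/-! ### The free *-algebra on a set -/

/-- The free unital complex *-algebra on the set `X`, i.e. the *-algebra of noncommutative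
polynomials in the letters `x` (encoded as `(x, false)`) and `x*` (encoded as `(x, true)`). -/
def FreeStarAlgebra (X : Type*) : Type _ := MonoidAlgebra ℂ (FreeMonoid (X × Bool))

namespace FreeStarAlgebra

variable (X : Type*)

instance : Ring (FreeStarAlgebra X) :=
  inferInstanceAs (Ring (MonoidAlgebra ℂ (FreeMonoid (X × Bool))))
instance : Algebra ℂ (FreeStarAlgebra X) :=
  inferInstanceAs (Algebra ℂ (MonoidAlgebra ℂ (FreeMonoid (X × Bool))))

variable {X}

/-- The monomial given by a word in the letters. -/
def monomial (w : FreeMonoid (X × Bool)) (c : ℂ) : FreeStarAlgebra X := MonoidAlgebra.single w c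

theorem monomial_mul (v w : FreeMonoid (X × Bool)) (c d : ℂ) :
    monomial v c * monomial w d = monomial (v * w) (c * d) :=
  MonoidAlgebra.single_mul_single ..

/-- The adjoint of a word: the word is reversed and every letter replaced by its adjoint. -/
def wordStar (w : FreeMonoid (X × Bool)) : FreeMonoid (X × Bool) :=
  star (FreeMonoid.map (fun l => (l.1, !l.2)) w)

theorem wordStar_one : wordStar (1 : FreeMonoid (X × Bool)) = 1 := rfl

theorem wordStar_mul (v w : FreeMonoid (X × Bool)) :
    wordStar (v * w) = wordStar w * wordStar v := by
  rw [wordStar, map_mul, StarMul.star_mul]; rfl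

/-- The involution as a homomorphism to the opposite ring. It takes the word `w` with
coefficient `c` to the word `w*` with coefficient `conj c`. -/
def starHom : MonoidAlgebra ℂ (FreeMonoid (X × Bool)) →+*
    (MonoidAlgebra ℂ (FreeMonoid (X × Bool)))ᵐᵒᵖ :=
  MonoidAlgebra.liftNCRingHom
    ((algebraMap ℂ (MonoidAlgebra ℂ (FreeMonoid (X × Bool)))ᵐᵒᵖ).comp (starRingEnd ℂ))
    { toFun := fun w => MulOpposite.op (MonoidAlgebra.single (wordStar w) 1)
      map_one' := by
        rw [wordStar_one, ← MonoidAlgebra.one_def, MulOpposite.op_one]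
      map_mul' := fun v w => by
        rw [← MulOpposite.op_mul, MonoidAlgebra.single_mul_single, wordStar_mul, one_mul] }
    (fun c w => by
      rw [RingHom.comp_apply]
      exact Algebra.commute_algebraMap_left _ _)

theorem starHom_single (w : FreeMonoid (X × Bool)) (c : ℂ) :
    starHom (MonoidAlgebra.single w c) =
      MulOpposite.op (MonoidAlgebra.single (wordStar w) (star c)) := by
  rw [starHom, MonoidAlgebra.liftNCRingHom_single]
  simp [← MulOpposite.op_mul]

theorem wordStar_wordStar (w : FreeMonoid (X × Bool)) : wordStar (wordStar w) = w := by
  induction w using FreeMonoid.inductionOn' with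
  | one => rfl
  | of_mul l w ih =>
    rw [wordStar_mul, wordStar_mul, ih]
    simp [wordStar]

instance : StarRing (FreeStarAlgebra X) where
  star a := (starHom a).unop
  star_involutive a := by
    refine MonoidAlgebra.induction_linear (motive := fun a =>
      (starHom (starHom a).unop).unop = a) a ?_ ?_ ?_
    · simp
    · intro x y hx hy
      simp [hx, hy]
    · intro w c
      rw [starHom_single, MulOpposite.unop_op, starHom_single, MulOpposite.unop_op,
        star_star, wordStar_wordStar]
  star_mul a b := congrArg MulOpposite.unop (map_mul starHom a b)
  star_add a b := congrArg MulOpposite.unop (map_add starHom a b)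

theorem star_monomial (w : FreeMonoid (X × Bool)) (c : ℂ) :
    star (monomial w c) = monomial (wordStar w) (star c) :=
  congrArg MulOpposite.unop (starHom_single w c)

theorem star_algebraMap (c : ℂ) :
    star (algebraMap ℂ (FreeStarAlgebra X) c) = algebraMap ℂ (FreeStarAlgebra X) (star c) :=
  star_monomial 1 c

instance : StarModule ℂ (FreeStarAlgebra X) where
  star_smul c a := by
    rw [Algebra.smul_def, StarMul.star_mul, star_algebraMap, ← Algebra.commutes, ← Algebra.smul_def]

/-- The generator `x` of the free *-algebra. -/
def gen (x : X) : FreeStarAlgebra X := monomial (FreeMonoid.of (x, false)) 1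

theorem star_gen (x : X) : star (gen x) = monomial (FreeMonoid.of (x, true)) 1 := by
  rw [gen, star_monomial, star_one]; rfl

/-- The relations `R` define a universal C*-algebra as soon as the C*-seminorms that vanish on `R`
are bounded at the generators. -/
theorem cstarBounded {R : Set (FreeStarAlgebra X)}
    (h : ∀ x, BddAbove (cstarSeminormValues R (gen x))) : CStarBounded R where
  bddAbove a := by
    have hw : ∀ w : FreeMonoid (X × Bool), BddAbove (cstarSeminormValues R (monomial w 1)) := by
      intro w
      induction w using FreeMonoid.inductionOn' with
      | one => exact bddAbove_values_one
      | of_mul l w ih =>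
        have hl : BddAbove (cstarSeminormValues R (monomial (FreeMonoid.of l) 1)) := by
          obtain ⟨x, b⟩ := l
          cases b
          · exact h x
          · rw [← star_gen]; exact bddAbove_values_star (h x)
        have := bddAbove_values_mul hl ih
        rwa [monomial_mul, one_mul] at this
    refine MonoidAlgebra.induction_on (motive := fun a : FreeStarAlgebra X =>
      BddAbove (cstarSeminormValues R a)) a hw ?_ ?_
    · exact fun x y hx hy => bddAbove_values_add hx hy
    · exact fun c x hx => bddAbove_values_smul c hx

end FreeStarAlgebra

/-! ### Brown algebras -/

/-- The defining relations of the Brown algebra, `∑ₖ uᵢₖ uₗₖ* = δᵢₗ 1` and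
`∑ᵢ uᵢₖ* uᵢₗ = δₖₗ 1`, each one written as an element that is to vanish. -/
def brownRelations (n : ℕ) : Set (FreeStarAlgebra (Fin n × Fin n)) :=
  {r | ∃ i l : Fin n, r = ∑ k, FreeStarAlgebra.gen (i, k) * star (FreeStarAlgebra.gen (l, k)) -
      if i = l then 1 else 0} ∪
  {r | ∃ k l : Fin n, r = ∑ i, star (FreeStarAlgebra.gen (i, k)) * FreeStarAlgebra.gen (i, l) -
      if k = l then 1 else 0}

theorem norm_le_one_of_sum_star_mul_self {B : Type*} [CStarAlgebra B] {n : ℕ} (f : Fin n → B)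
    (h : ∑ i, star (f i) * f i = 1) (i : Fin n) : ‖f i‖ ≤ 1 := by
  let _ : PartialOrder B := CStarAlgebra.spectralOrder B
  let _ : StarOrderedRing B := CStarAlgebra.spectralOrderedRing B
  rcases subsingleton_or_nontrivial B with hB | hB
  · rw [Subsingleton.elim (f i) 0, norm_zero]; exact zero_le_one
  have h1 : star (f i) * f i ≤ 1 := by
    rw [← h]
    exact Finset.single_le_sum (f := fun i => star (f i) * f i)
      (fun j _ => star_mul_self_nonneg (f j)) (Finset.mem_univ i)
  have h2 := CStarAlgebra.norm_le_norm_of_nonneg_of_le (star_mul_self_nonneg (f i)) h1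
  rw [CStarRing.norm_star_mul_self, CStarRing.norm_one] at h2
  nlinarith [norm_nonneg (f i)]

instance (n : ℕ) : CStarBounded (brownRelations n) := FreeStarAlgebra.cstarBounded (by
  rintro ⟨i, k⟩
  refine ⟨1, ?_⟩
  rintro _ ⟨p, hp, rfl⟩
  have h := hp _ (Or.inr ⟨k, k, rfl⟩)
  rw [← p.norm_toCompletion, norm_eq_zero, if_pos rfl, map_sub, sub_eq_zero, map_sum,
    map_one] at h
  simp only [map_mul, map_star] at h
  rw [← p.norm_toCompletion]
  exact norm_le_one_of_sum_star_mul_self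
    (fun i => p.toCompletion (FreeStarAlgebra.gen (i, k))) h i)

/-- The Brown algebra `U(n)`: the universal unital C*-algebra generated by the entries of a
unitary `n × n` matrix. -/
abbrev BrownAlgebra (n : ℕ) : Type := UniversalCStarAlgebra (brownRelations n)

/-- The generator `uᵢⱼ` of the Brown algebra. -/
def BrownAlgebra.gen {n : ℕ} (i j : Fin n) : BrownAlgebra n :=
  UniversalCStarAlgebra.of (brownRelations n) (FreeStarAlgebra.gen (i, j))

/-! ### Full free products of unital C*-algebras -/

section FreeProduct

variable {ι : Type*} (A : ι → Type*) [∀ x, CStarAlgebra (A x)]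

/-- The relations of the full (unital) free product: each `A x` is mapped to it by a unital
*-homomorphism. -/
inductive CStarFreeProduct.Relation : FreeStarAlgebra (Σ x, A x) → Prop
  | one (x : ι) : Relation (FreeStarAlgebra.gen ⟨x, 1⟩ - 1)
  | add (x : ι) (a b : A x) : Relation (FreeStarAlgebra.gen ⟨x, a + b⟩ -
      (FreeStarAlgebra.gen ⟨x, a⟩ + FreeStarAlgebra.gen ⟨x, b⟩))
  | smul (x : ι) (c : ℂ) (a : A x) : Relation (FreeStarAlgebra.gen ⟨x, c • a⟩ -
      c • FreeStarAlgebra.gen ⟨x, a⟩)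
  | mul (x : ι) (a b : A x) : Relation (FreeStarAlgebra.gen ⟨x, a * b⟩ -
      FreeStarAlgebra.gen ⟨x, a⟩ * FreeStarAlgebra.gen ⟨x, b⟩)
  | adj (x : ι) (a : A x) : Relation (FreeStarAlgebra.gen ⟨x, star a⟩ -
      star (FreeStarAlgebra.gen ⟨x, a⟩))

/-- The set of the relations of the full free product. -/
def CStarFreeProduct.relations : Set (FreeStarAlgebra (Σ x, A x)) :=
  {r | CStarFreeProduct.Relation A r}

/-- A C*-seminorm that vanishes on the relations defines a *-homomorphism on each factor. -/
def CStarFreeProduct.factorHom {p : CStarSeminorm (FreeStarAlgebra (Σ x, A x))}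
    (hp : ∀ r ∈ CStarFreeProduct.relations A, p r = 0) (x : ι) : A x →⋆ₙₐ[ℂ] p.Completion where
  toFun a := p.toCompletion (FreeStarAlgebra.gen ⟨x, a⟩)
  map_smul' c a := by
    have h := hp _ (.smul x c a)
    rw [← p.norm_toCompletion, norm_eq_zero, map_sub, sub_eq_zero, map_smul] at h
    exact h
  map_zero' := by
    have h := hp _ (.smul x 0 0)
    rwa [← p.norm_toCompletion, norm_eq_zero, map_sub, sub_eq_zero, map_smul, zero_smul,
      zero_smul] at h
  map_add' a b := by
    have h := hp _ (.add x a b)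
    rwa [← p.norm_toCompletion, norm_eq_zero, map_sub, sub_eq_zero, map_add] at h
  map_mul' a b := by
    have h := hp _ (.mul x a b)
    rwa [← p.norm_toCompletion, norm_eq_zero, map_sub, sub_eq_zero, map_mul] at h
  map_star' a := by
    have h := hp _ (.adj x a)
    rwa [← p.norm_toCompletion, norm_eq_zero, map_sub, sub_eq_zero, map_star] at h

instance : CStarBounded (CStarFreeProduct.relations A) := FreeStarAlgebra.cstarBounded (by
  rintro ⟨x, a⟩
  refine ⟨‖a‖, ?_⟩
  rintro _ ⟨p, hp, rfl⟩
  rw [← p.norm_toCompletion]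
  exact NonUnitalStarAlgHom.norm_apply_le (CStarFreeProduct.factorHom A hp x) a)

/-- The full free product of the unital C*-algebras `A x`, with amalgamation of the units. -/
abbrev CStarFreeProduct : Type _ := UniversalCStarAlgebra (CStarFreeProduct.relations A)

/-- The canonical map of the factor `A x` to the full free product. -/
def CStarFreeProduct.incl (x : ι) (a : A x) : CStarFreeProduct A :=
  UniversalCStarAlgebra.of (CStarFreeProduct.relations A) (FreeStarAlgebra.gen ⟨x, a⟩)

end FreeProduct

/-! ### Maximal tensor products of unital C*-algebras -/

section MaxTensor

variable (A B : Type*) [CStarAlgebra A] [CStarAlgebra B]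

instance : CStarBounded (∅ : Set (A ⊗[ℂ] B)) where
  bddAbove z := by
    refine TensorProduct.induction_on z ?_ ?_ fun _ _ => bddAbove_values_add
    · exact ⟨0, by rintro _ ⟨p, -, rfl⟩; exact (map_zero p.toSeminorm).le⟩
    · intro a b
      have h : a ⊗ₜ[ℂ] b = (a ⊗ₜ[ℂ] (1 : B)) * ((1 : A) ⊗ₜ[ℂ] b) := by simp
      rw [h]
      refine bddAbove_values_mul ⟨‖a‖, ?_⟩ ⟨‖b‖, ?_⟩
      · rintro _ ⟨p, -, rfl⟩
        rw [← p.norm_toCompletion]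
        exact NonUnitalStarAlgHom.norm_apply_le (p.toCompletion.toNonUnitalStarAlgHom.comp
          ({ toFun := fun a => a ⊗ₜ[ℂ] (1 : B)
             map_smul' := fun c a => TensorProduct.smul_tmul' c a 1
             map_zero' := TensorProduct.zero_tmul _ _
             map_add' := fun a b => TensorProduct.add_tmul a b 1
             map_mul' := fun a b => by simp
             map_star' := fun a => by simp } : A →⋆ₙₐ[ℂ] A ⊗[ℂ] B)) a
      · rintro _ ⟨p, -, rfl⟩
        rw [← p.norm_toCompletion]
        exact NonUnitalStarAlgHom.norm_apply_le (p.toCompletion.toNonUnitalStarAlgHom.comp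
          ({ toFun := fun b => (1 : A) ⊗ₜ[ℂ] b
             map_smul' := fun c b => TensorProduct.tmul_smul c 1 b
             map_zero' := TensorProduct.tmul_zero _ _
             map_add' := fun a b => TensorProduct.tmul_add 1 a b
             map_mul' := fun a b => by simp
             map_star' := fun a => by simp } : B →⋆ₙₐ[ℂ] A ⊗[ℂ] B)) b

/-- The maximal tensor product: the completion of the algebraic tensor product with respect
to the largest C*-seminorm. -/
abbrev MaxTensorProduct : Type _ := UniversalCStarAlgebra (∅ : Set (A ⊗[ℂ] B))

variable {A B}

/-- The elementary tensor `a ⊗ b` in the maximal tensor product. -/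
def maxTmul (a : A) (b : B) : MaxTensorProduct A B :=
  UniversalCStarAlgebra.of (∅ : Set (A ⊗[ℂ] B)) (a ⊗ₜ[ℂ] b)

end MaxTensor

/-! ### States and unitary induced channels -/

/-- A state on a unital *-algebra: a linear functional that is positive and unital. -/
structure State (A : Type*) [Ring A] [StarRing A] [Algebra ℂ A] extends A →ₗ[ℂ] ℂ where
  map_one' : toFun 1 = 1
  nonneg' : ∀ a : A, 0 ≤ toFun (star a * a)

instance {A : Type*} [Ring A] [StarRing A] [Algebra ℂ A] : CoeFun (State A) (fun _ => A → ℂ) :=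
  ⟨fun φ => φ.toLinearMap⟩

/-- The matrix algebra `Mₙ(ℂ)`. -/
abbrev Mat (n : ℕ) : Type := Matrix (Fin n) (Fin n) ℂ

/-- The matrix unit `Eᵢⱼ`. -/
abbrev matUnit {n : ℕ} (i j : Fin n) : Mat n := Matrix.single i j 1

section Channels

variable {n : ℕ} {C : Type*} [Ring C] [Algebra ℂ C]

/-- `U ⊗ 1` in `A' ⊗ C ⊗ B'`, with `A' = B' = Mₙ(ℂ)`, where `U = ∑ Eᵢⱼ ⊗ uᵢⱼ` is an element of
`Mₙ(C) = A' ⊗ C`. -/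
def aliceOp (U : Matrix (Fin n) (Fin n) C) : (Mat n ⊗[ℂ] C) ⊗[ℂ] Mat n :=
  (∑ i, ∑ j, matUnit i j ⊗ₜ[ℂ] U i j) ⊗ₜ[ℂ] 1

/-- `1 ⊗ V` in `A' ⊗ C ⊗ B'`, where `V = ∑ vₖₗ ⊗ Eₖₗ` is an element of `Mₙ(C) = C ⊗ B'`. -/
def bobOp (V : Matrix (Fin n) (Fin n) C) : (Mat n ⊗[ℂ] C) ⊗[ℂ] Mat n :=
  ∑ k, ∑ l, (1 ⊗ₜ[ℂ] V k l) ⊗ₜ[ℂ] matUnit k l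

/-- The product functional `φ' ⊗ φ` on `A' ⊗ C ⊗ B'`, where `φ'` is a functional on `A' ⊗ B'` and
`φ` is a functional on `C`; it takes `g ⊗ c ⊗ h` to `φ' (g ⊗ h) * φ c`. -/
def productFunctional (φ' : (Mat n ⊗[ℂ] Mat n) →ₗ[ℂ] ℂ) (φ : C →ₗ[ℂ] ℂ) :
    ((Mat n ⊗[ℂ] C) ⊗[ℂ] Mat n) →ₗ[ℂ] ℂ :=
  LinearMap.mul' ℂ ℂ ∘ₗ TensorProduct.map φ' φ ∘ₗ
    (TensorProduct.rightComm ℂ (Mat n) C (Mat n)).toLinearMap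

theorem productFunctional_tmul (φ' : (Mat n ⊗[ℂ] Mat n) →ₗ[ℂ] ℂ) (φ : C →ₗ[ℂ] ℂ)
    (g h : Mat n) (c : C) :
    productFunctional φ' φ ((g ⊗ₜ c) ⊗ₜ h) = φ' (g ⊗ₜ h) * φ c := rfl

end Channels

/-- The families `{Λₓᵧ}`, `x, y = 1, …, m`, of maps `S(Mₙ ⊗ Mₙ) → S(Mₙ ⊗ Mₙ)`. -/
abbrev ChannelFamily (m n : ℕ) : Type :=
  Fin m → Fin m → State (Mat n ⊗[ℂ] Mat n) → State (Mat n ⊗[ℂ] Mat n)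

/-- The set `L_qc(m, n)` of the generalized unitary induced channels in the quantum commuting
model. -/
def Lqc (m n : ℕ) : Set (ChannelFamily m n) :=
  {Λ | ∃ (H : Type u) (_ : NormedAddCommGroup H) (_ : InnerProductSpace ℂ H) (_ : CompleteSpace H)
    (φ : State (H →L[ℂ] H)) (U V : Fin m → Matrix (Fin n) (Fin n) (H →L[ℂ] H)),
    (∀ x, U x ∈ unitary (Matrix (Fin n) (Fin n) (H →L[ℂ] H))) ∧
    (∀ y, V y ∈ unitary (Matrix (Fin n) (Fin n) (H →L[ℂ] H))) ∧
    (∀ x y, aliceOp (U x) * bobOp (V y) = bobOp (V y) * aliceOp (U x)) ∧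
    ∀ (x y : Fin m) (φ' : State (Mat n ⊗[ℂ] Mat n)) (g h : Mat n),
      Λ x y φ' (g ⊗ₜ h) = productFunctional φ'.toLinearMap φ.toLinearMap
        (aliceOp (U x) * bobOp (V y) * ((g ⊗ₜ 1) ⊗ₜ h) *
          bobOp (star (V y)) * aliceOp (star (U x)))}

/-- The family `Λ` is given by the state `φ` on `A ⊗_max B` and the matrices `Uˣ = (uˣᵢⱼ)` over `A`
and `Vʸ = (vʸₖₗ)` over `B` according to the formula
`Λₓᵧ(φ')(g ⊗ h) = ∑ φ'(Eᵢⱼ g Eₖₗ ⊗ Eₚᵣ h Eₛₜ) φ(uˣᵢⱼ (uˣₗₖ)* ⊗ vʸₚᵣ (vʸₜₛ)*)`. -/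
def IsGivenBy {m n : ℕ} {A B : Type*} [CStarAlgebra A] [CStarAlgebra B] (Λ : ChannelFamily m n)
    (φ : State (MaxTensorProduct A B)) (U : Fin m → Matrix (Fin n) (Fin n) A)
    (V : Fin m → Matrix (Fin n) (Fin n) B) : Prop :=
  ∀ (x y : Fin m) (φ' : State (Mat n ⊗[ℂ] Mat n)) (g h : Mat n),
    Λ x y φ' (g ⊗ₜ h) = ∑ i, ∑ j, ∑ k, ∑ l, ∑ p, ∑ r, ∑ s, ∑ t,
      φ' ((matUnit i j * g * matUnit k l) ⊗ₜ (matUnit p r * h * matUnit s t)) *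
        φ (maxTmul (U x i j * star (U x l k)) (V y p r * star (V y t s)))

/-- The full free product of `m` copies of the Brown algebra `U(n)`. -/
abbrev BrownFreeProduct (m n : ℕ) : Type := CStarFreeProduct (fun _ : Fin m => BrownAlgebra n)

/-- The matrix of the generators of the `x`-th copy of `U(n)` in the full free product. -/
def brownMatrix {m n : ℕ} (x : Fin m) : Matrix (Fin n) (Fin n) (BrownFreeProduct m n) :=
  Matrix.of fun i j => CStarFreeProduct.incl (fun _ : Fin m => BrownAlgebra n) x
    (BrownAlgebra.gen i j)

end

/-! ### Universal properties -/

/-! All three conditions feed the same numbers into one formula: the values of a state on products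
of a word `uᵢⱼ uₗₖ*` of Alice with a word `vₚᵣ vₜₛ*` of Bob. Only the algebra carrying the state
changes, so the proof moves states along unital *-homomorphisms that respect the matrices.

The free product of Brown algebras is universal for `m`-tuples of unitary matrices, and `⊗_max` is
universal for commuting pairs of *-homomorphisms. Hence any data over `A ⊗_max B` pull back to the
universal algebra (`exists_isGivenBy_brownMatrix`), which gives 2 → 3; for 3 → 2 take the universal
matrices themselves.

For 1 → 3, comparing coefficients of matrix units shows that the entries of `Uˣ` commute with those
of `Vʸ`. They also commute with the adjoints of those entries, because `1 ⊗ (Vʸ)*` is the inverse of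
`1 ⊗ Vʸ`. So the two families lie in commuting C*-subalgebras of `B(H)`, and the state on `B(H)`
induces one on their maximal tensor product (`exists_isGivenBy_of_commute`). The same commutation
turns the conjugation formula into the eightfold sum (`productFunctional_conj`).

For 3 → 1, the GNS construction realises the state as a vector state; the images of the two tensor
legs commute (`IsGivenBy.mem_Lqc_of_representation`). -/

section Lift

variable {A : Type*} [Ring A] [StarRing A] [Algebra ℂ A] {C : Type*} [CStarAlgebra C]

/-- The C*-seminorm `a ↦ ‖f a‖` defined by a *-homomorphism to a C*-algebra. -/
noncomputable def CStarSeminorm.ofHom (f : A →⋆ₐ[ℂ] C) : CStarSeminorm A where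
  toSeminorm := (normSeminorm ℂ C).comp f.toAlgHom.toLinearMap
  mul_le' a b := by
    change ‖f (a * b)‖ ≤ ‖f a‖ * ‖f b‖
    rw [map_mul]
    exact norm_mul_le _ _
  star_mul_self' a := by
    change ‖f (star a * a)‖ = ‖f a‖ * ‖f a‖
    rw [map_mul, map_star, CStarRing.norm_star_mul_self]

theorem CStarSeminorm.ofHom_apply (f : A →⋆ₐ[ℂ] C) (a : A) : ofHom f a = ‖f a‖ := rfl

section

variable (p : CStarSeminorm A) (f : A →⋆ₐ[ℂ] C) (hf : ∀ a, ‖f a‖ ≤ p a)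

/-- A contractive *-homomorphism, regarded as a ring homomorphism on the seminormed algebra. -/
def CStarSeminorm.preHom : p.Pre →+* C := f.toAlgHom.toRingHom

include hf in
theorem CStarSeminorm.continuous_preHom : Continuous (p.preHom f) :=
  AddMonoidHomClass.continuous_of_bound (p.preHom f) 1 fun a => by
    rw [one_mul]
    exact hf a

/-- The extension of a contractive *-homomorphism to the completion. -/
noncomputable def CStarSeminorm.completionLift : p.Completion →⋆ₐ[ℂ] C :=
  let F : p.Completion →+* C :=
    UniformSpace.Completion.extensionHom (p.preHom f) (p.continuous_preHom f hf)
  have hF : Continuous F := UniformSpace.Completion.continuous_extension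
  have hFe : ∀ a, F (p.embed a) = f a :=
    UniformSpace.Completion.extensionHom_coe (p.preHom f) (p.continuous_preHom f hf)
  { F with
    commutes' := fun c => by
      -- Scalars come from `A`, where the extension agrees with `f`.
      have h : algebraMap ℂ p.Completion c = p.embed (algebraMap ℂ A c) := by
        rw [Algebra.algebraMap_eq_smul_one, Algebra.algebraMap_eq_smul_one, p.embed_smul,
          p.embed_one]
      change F _ = _
      rw [h, hFe, AlgHomClass.commutes]
    map_star' := fun x => by
      refine p.completion_induction (P := fun x => F (star x) = star (F x)) x
        (isClosed_eq (by fun_prop) (by fun_prop)) fun a => ?_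
      rw [← p.embed_star, hFe, hFe, map_star] }

theorem CStarSeminorm.completionLift_embed (a : A) : p.completionLift f hf (p.embed a) = f a :=
  UniformSpace.Completion.extensionHom_coe (p.preHom f) (p.continuous_preHom f hf) a

end

variable [StarModule ℂ A] (R : Set A) [CStarBounded R]

theorem UniversalCStarAlgebra.of_eq_zero {r : A} (hr : r ∈ R) :
    UniversalCStarAlgebra.of R r = 0 := by
  rw [← norm_eq_zero, CStarSeminorm.norm_toCompletion]
  refine le_antisymm (csSup_le (cstarSeminormValues_nonempty R r) ?_)
    (sSup_cstarSeminormValues_nonneg R r)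
  rintro _ ⟨p, hp, rfl⟩
  exact (hp r hr).le

/-- The universal property of the universal C*-algebra. -/
noncomputable def UniversalCStarAlgebra.lift (f : A →⋆ₐ[ℂ] C) (hf : ∀ r ∈ R, f r = 0) :
    UniversalCStarAlgebra R →⋆ₐ[ℂ] C :=
  (universalCStarSeminorm R).completionLift f
    -- The seminorm `‖f ·‖` vanishes on `R`, hence is dominated by the largest such C*-seminorm;
    -- this is the contractivity needed to extend `f`.
    ((CStarSeminorm.ofHom f).le_sSup fun r hr => by
      rw [CStarSeminorm.ofHom_apply, hf r hr, norm_zero])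

omit [StarModule ℂ A] in
theorem UniversalCStarAlgebra.lift_of (f : A →⋆ₐ[ℂ] C) (hf : ∀ r ∈ R, f r = 0) (a : A) :
    UniversalCStarAlgebra.lift R f hf (UniversalCStarAlgebra.of R a) = f a :=
  CStarSeminorm.completionLift_embed _ _ _ a

end Lift

/-! ### Free *-algebra: universal property -/

namespace FreeStarAlgebra

variable {X : Type*} {C : Type*} [Ring C] [StarRing C] [Algebra ℂ C] [StarModule ℂ C]

/-- The value at a word of the multiplicative extension of a map on the letters. -/
def wordLift (f : X → C) : FreeMonoid (X × Bool) →* C :=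
  FreeMonoid.lift fun l => if l.2 then star (f l.1) else f l.1

omit [Algebra ℂ C] [StarModule ℂ C] in
theorem wordLift_wordStar (f : X → C) (w : FreeMonoid (X × Bool)) :
    wordLift f (wordStar w) = star (wordLift f w) := by
  induction w using FreeMonoid.inductionOn' with
  | one => simp [wordStar_one]
  | of_mul l w ih =>
    rw [wordStar_mul, map_mul, map_mul, ih, star_mul]
    obtain ⟨x, b⟩ := l
    cases b <;> simp [wordStar, wordLift]

/-- The universal property of the free *-algebra. -/
noncomputable def lift (f : X → C) : FreeStarAlgebra X →⋆ₐ[ℂ] C :=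
  let F : FreeStarAlgebra X →ₐ[ℂ] C := MonoidAlgebra.lift ℂ C (FreeMonoid (X × Bool)) (wordLift f)
  have hF : ∀ w c, F (monomial w c) = c • wordLift f w := fun w c =>
    MonoidAlgebra.lift_single (wordLift f) w c
  { F with
    map_star' := fun a => by
      change F (star a) = star (F a)
      refine MonoidAlgebra.induction_linear (motive := fun a : FreeStarAlgebra X =>
        F (star a) = star (F a)) a ?_ ?_ ?_
      · change F (star (0 : FreeStarAlgebra X)) = star (F (0 : FreeStarAlgebra X))
        rw [star_zero, map_zero, star_zero]
      · intro (x : FreeStarAlgebra X) (y : FreeStarAlgebra X) hx hy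
        change F (star (x + y : FreeStarAlgebra X)) = star (F (x + y : FreeStarAlgebra X))
        rw [star_add, map_add, hx, hy, map_add, star_add]
      · intro w c
        change F (star (monomial w c)) = star (F (monomial w c))
        rw [star_monomial, hF, hF, wordLift_wordStar, star_smul] }

theorem lift_gen (f : X → C) (x : X) : lift f (gen x) = f x := by
  refine (MonoidAlgebra.lift_single (wordLift f) (FreeMonoid.of (x, false)) (1 : ℂ)).trans ?_
  rw [one_smul]
  exact FreeMonoid.lift_eval_of _ _

end FreeStarAlgebra

/-! ### Brown algebra: universal property -/

section Brown

variable {n : ℕ}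

/-- The two families of Brown relations are, entry by entry, the identities `U U* = 1` and `U* U =
1`. -/
theorem BrownAlgebra.of_gen_mem_unitary :
    (Matrix.of fun i j => BrownAlgebra.gen i j) ∈
      unitary (Matrix (Fin n) (Fin n) (BrownAlgebra n)) := by
  refine Unitary.mem_iff.mpr ⟨?_, ?_⟩
  · ext k l
    have h := UniversalCStarAlgebra.of_eq_zero (brownRelations n) (Or.inr ⟨k, l, rfl⟩)
    rw [map_sub, sub_eq_zero, map_sum, apply_ite (UniversalCStarAlgebra.of _), map_one,
      map_zero] at h
    simp only [map_mul, map_star] at h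
    rw [Matrix.mul_apply, Matrix.one_apply]
    exact h
  · ext i l
    have h := UniversalCStarAlgebra.of_eq_zero (brownRelations n) (Or.inl ⟨i, l, rfl⟩)
    rw [map_sub, sub_eq_zero, map_sum, apply_ite (UniversalCStarAlgebra.of _), map_one,
      map_zero] at h
    simp only [map_mul, map_star] at h
    rw [Matrix.mul_apply, Matrix.one_apply]
    exact h

variable {C : Type*} [CStarAlgebra C]

/-- The universal property of the Brown algebra. -/
noncomputable def BrownAlgebra.lift (U : Matrix (Fin n) (Fin n) C)
    (hU : U ∈ unitary (Matrix (Fin n) (Fin n) C)) : BrownAlgebra n →⋆ₐ[ℂ] C :=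
  UniversalCStarAlgebra.lift _ (FreeStarAlgebra.lift fun ij : Fin n × Fin n => U ij.1 ij.2) (by
    rintro _ (⟨i, l, rfl⟩ | ⟨k, l, rfl⟩)
    · have h := congrFun (congrFun (Unitary.mem_iff.mp hU).2 i) l
      rw [Matrix.mul_apply, Matrix.one_apply] at h
      rw [map_sub, sub_eq_zero, map_sum, apply_ite (FreeStarAlgebra.lift _), map_one, map_zero]
      simp only [map_mul, map_star, FreeStarAlgebra.lift_gen]
      exact h
    · have h := congrFun (congrFun (Unitary.mem_iff.mp hU).1 k) l
      rw [Matrix.mul_apply, Matrix.one_apply] at h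
      rw [map_sub, sub_eq_zero, map_sum, apply_ite (FreeStarAlgebra.lift _), map_one, map_zero]
      simp only [map_mul, map_star, FreeStarAlgebra.lift_gen]
      exact h)

theorem BrownAlgebra.lift_gen (U : Matrix (Fin n) (Fin n) C)
    (hU : U ∈ unitary (Matrix (Fin n) (Fin n) C)) (i j : Fin n) :
    BrownAlgebra.lift U hU (BrownAlgebra.gen i j) = U i j :=
  (UniversalCStarAlgebra.lift_of _ _ _ _).trans (FreeStarAlgebra.lift_gen _ _)

end Brown

/-! ### Full free product: universal property -/

section FreeProduct

variable {ι : Type*} (A : ι → Type*) [∀ x, CStarAlgebra (A x)]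

/-- The canonical *-homomorphism of a factor to the full free product. -/
noncomputable def CStarFreeProduct.inclHom (x : ι) : A x →⋆ₐ[ℂ] CStarFreeProduct A :=
  let f : A x →⋆ₙₐ[ℂ] CStarFreeProduct A :=
    CStarFreeProduct.factorHom A (p := universalCStarSeminorm (CStarFreeProduct.relations A))
      (fun r hr => by
        have h := UniversalCStarAlgebra.of_eq_zero (CStarFreeProduct.relations A) hr
        rwa [← norm_eq_zero, CStarSeminorm.norm_toCompletion] at h) x
  have h1 : f 1 = 1 := by
    have h := UniversalCStarAlgebra.of_eq_zero (CStarFreeProduct.relations A) (.one x)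
    rwa [map_sub, sub_eq_zero, map_one] at h
  { f with
    map_one' := h1
    commutes' := fun c => by
      change f _ = _
      rw [Algebra.algebraMap_eq_smul_one, map_smul, h1, ← Algebra.algebraMap_eq_smul_one] }

variable {C : Type*} [CStarAlgebra C]

/-- The universal property of the full free product. -/
noncomputable def CStarFreeProduct.lift (f : ∀ x, A x →⋆ₐ[ℂ] C) : CStarFreeProduct A →⋆ₐ[ℂ] C :=
  UniversalCStarAlgebra.lift _ (FreeStarAlgebra.lift fun a : Σ x, A x => f a.1 a.2) (by
    rintro _ (x | ⟨x, a, b⟩ | ⟨x, c, a⟩ | ⟨x, a, b⟩ | ⟨x, a⟩) <;>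
      simp [FreeStarAlgebra.lift_gen, map_star])

theorem CStarFreeProduct.lift_incl (f : ∀ x, A x →⋆ₐ[ℂ] C) (x : ι) (a : A x) :
    CStarFreeProduct.lift A f (CStarFreeProduct.incl A x a) = f x a :=
  (UniversalCStarAlgebra.lift_of _ _ _ _).trans (FreeStarAlgebra.lift_gen _ _)

end FreeProduct

theorem Matrix.map_mem_unitary {n : Type*} [Fintype n] [DecidableEq n] {A B : Type*} [Ring A]
    [StarRing A] [Algebra ℂ A] [Ring B] [StarRing B] [Algebra ℂ B] (f : A →⋆ₐ[ℂ] B)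
    {U : Matrix n n A} (hU : U ∈ unitary (Matrix n n A)) :
    U.map f ∈ unitary (Matrix n n B) := by
  have hs : star (U.map f) = (star U).map f := by
    ext i j
    exact (map_star f (U j i)).symm
  have h1 : (1 : Matrix n n A).map f = 1 := Matrix.map_one f (map_zero f) (map_one f)
  rw [Unitary.mem_iff, hs, ← Matrix.map_mul, ← Matrix.map_mul, (Unitary.mem_iff.mp hU).1,
    (Unitary.mem_iff.mp hU).2, h1]
  exact ⟨rfl, rfl⟩

theorem brownMatrix_mem_unitary {m n : ℕ} (x : Fin m) :
    brownMatrix x ∈ unitary (Matrix (Fin n) (Fin n) (BrownFreeProduct m n)) :=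
  Matrix.map_mem_unitary (CStarFreeProduct.inclHom (fun _ : Fin m => BrownAlgebra n) x)
    BrownAlgebra.of_gen_mem_unitary

/-- The *-homomorphism from the free product of Brown algebras defined by a family of unitary
matrices. -/
noncomputable def BrownFreeProduct.lift {m n : ℕ} {C : Type*} [CStarAlgebra C]
    (U : Fin m → Matrix (Fin n) (Fin n) C)
    (hU : ∀ x, U x ∈ unitary (Matrix (Fin n) (Fin n) C)) : BrownFreeProduct m n →⋆ₐ[ℂ] C :=
  CStarFreeProduct.lift _ fun x => BrownAlgebra.lift (U x) (hU x)

theorem BrownFreeProduct.lift_brownMatrix {m n : ℕ} {C : Type*} [CStarAlgebra C]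
    (U : Fin m → Matrix (Fin n) (Fin n) C)
    (hU : ∀ x, U x ∈ unitary (Matrix (Fin n) (Fin n) C)) (x : Fin m) (i j : Fin n) :
    BrownFreeProduct.lift U hU (brownMatrix x i j) = U x i j :=
  (CStarFreeProduct.lift_incl _ _ _ _).trans (BrownAlgebra.lift_gen _ _ _ _)

/-! ### Maximal tensor product: universal property and functoriality -/

section MaxTensor

variable {A B C : Type*} [CStarAlgebra A] [CStarAlgebra B] [CStarAlgebra C]

/-- The universal property of the maximal tensor product. -/
noncomputable def MaxTensorProduct.lift (f : A →⋆ₐ[ℂ] C) (g : B →⋆ₐ[ℂ] C)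
    (h : ∀ a b, Commute (f a) (g b)) : MaxTensorProduct A B →⋆ₐ[ℂ] C :=
  let F : A ⊗[ℂ] B →ₐ[ℂ] C := Algebra.TensorProduct.lift f.toAlgHom g.toAlgHom h
  have hF : ∀ a b, F (a ⊗ₜ b) = f a * g b := Algebra.TensorProduct.lift_tmul _ _ h
  UniversalCStarAlgebra.lift ∅
    { F with
      map_star' := fun z => by
        change F (star z) = star (F z)
        induction z using TensorProduct.induction_on with
        | zero => simp
        | tmul a b =>
          -- The adjoint reverses `f a * g b`; commutation of the two ranges restores the order.
          rw [TensorProduct.star_tmul, hF, hF, star_mul, map_star, map_star, ← map_star f,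
            ← map_star g, (h _ _).eq]
        | add x y hx hy => rw [star_add, map_add, hx, hy, map_add, star_add] }
    (fun _ hr => hr.elim)

theorem MaxTensorProduct.lift_maxTmul (f : A →⋆ₐ[ℂ] C) (g : B →⋆ₐ[ℂ] C)
    (h : ∀ a b, Commute (f a) (g b)) (a : A) (b : B) :
    MaxTensorProduct.lift f g h (maxTmul a b) = f a * g b :=
  (UniversalCStarAlgebra.lift_of _ _ (fun _ hr => hr.elim) _).trans
    (Algebra.TensorProduct.lift_tmul _ _ h a b)

theorem maxTmul_mul_maxTmul (a a' : A) (b b' : B) :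
    maxTmul a b * maxTmul a' b' = maxTmul (a * a') (b * b') := by
  rw [maxTmul, maxTmul, maxTmul, ← map_mul, Algebra.TensorProduct.tmul_mul_tmul]

/-- The embedding `a ↦ a ⊗ 1` of the first factor. -/
noncomputable def MaxTensorProduct.inl : A →⋆ₐ[ℂ] MaxTensorProduct A B :=
  (UniversalCStarAlgebra.of ∅).comp
    { (Algebra.TensorProduct.includeLeft : A →ₐ[ℂ] A ⊗[ℂ] B) with
      map_star' := fun a => by simp }

/-- The embedding `b ↦ 1 ⊗ b` of the second factor. -/
noncomputable def MaxTensorProduct.inr : B →⋆ₐ[ℂ] MaxTensorProduct A B :=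
  (UniversalCStarAlgebra.of ∅).comp
    { (Algebra.TensorProduct.includeRight : B →ₐ[ℂ] A ⊗[ℂ] B) with
      map_star' := fun a => by simp }

theorem MaxTensorProduct.inl_mul_inr (a : A) (b : B) :
    (inl a * inr b : MaxTensorProduct A B) = maxTmul a b :=
  (maxTmul_mul_maxTmul a 1 1 b).trans (by rw [mul_one, one_mul])

theorem MaxTensorProduct.commute_inl_inr (a : A) (b : B) :
    Commute (inl a : MaxTensorProduct A B) (inr b) := by
  refine (inl_mul_inr a b).trans (Eq.trans ?_ (maxTmul_mul_maxTmul 1 a b 1).symm)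
  rw [mul_one, one_mul]

/-- The *-homomorphism of maximal tensor products defined by *-homomorphisms of the factors. -/
noncomputable def MaxTensorProduct.map {A' B' : Type*} [CStarAlgebra A'] [CStarAlgebra B']
    (f : A →⋆ₐ[ℂ] A') (g : B →⋆ₐ[ℂ] B') : MaxTensorProduct A B →⋆ₐ[ℂ] MaxTensorProduct A' B' :=
  MaxTensorProduct.lift (inl.comp f) (inr.comp g) fun a b => commute_inl_inr (f a) (g b)

theorem MaxTensorProduct.map_maxTmul {A' B' : Type*} [CStarAlgebra A'] [CStarAlgebra B']
    (f : A →⋆ₐ[ℂ] A') (g : B →⋆ₐ[ℂ] B') (a : A) (b : B) :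
    MaxTensorProduct.map f g (maxTmul a b) = maxTmul (f a) (g b) :=
  (MaxTensorProduct.lift_maxTmul _ _ _ a b).trans (inl_mul_inr _ _)

end MaxTensor

/-! ### Pulling back states and channel families -/

/-- The state `φ ∘ f` defined by a state `φ` and a unital *-homomorphism `f`. -/
def State.comp {A B : Type*} [Ring A] [StarRing A] [Algebra ℂ A] [Ring B] [StarRing B]
    [Algebra ℂ B] (φ : State B) (f : A →⋆ₐ[ℂ] B) : State A where
  toLinearMap := φ.toLinearMap ∘ₗ f.toAlgHom.toLinearMap
  map_one' := (congrArg φ (map_one f)).trans φ.map_one'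
  nonneg' a := by
    change 0 ≤ φ (f (star a * a))
    rw [map_mul, map_star]
    exact φ.nonneg' (f a)

theorem State.comp_apply {A B : Type*} [Ring A] [StarRing A] [Algebra ℂ A] [Ring B] [StarRing B]
    [Algebra ℂ B] (φ : State B) (f : A →⋆ₐ[ℂ] B) (a : A) : φ.comp f a = φ (f a) := rfl

/-- A family given by the pullback of a state is given by the state and the images of the
matrices. -/
theorem isGivenBy_comp_map {m n : ℕ} {A B A' B' : Type*} [CStarAlgebra A] [CStarAlgebra B]
    [CStarAlgebra A'] [CStarAlgebra B'] {Λ : ChannelFamily m n}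
    (φ : State (MaxTensorProduct A' B')) (f : A →⋆ₐ[ℂ] A') (g : B →⋆ₐ[ℂ] B')
    (U : Fin m → Matrix (Fin n) (Fin n) A) (V : Fin m → Matrix (Fin n) (Fin n) B) :
    IsGivenBy Λ (φ.comp (MaxTensorProduct.map f g)) U V ↔
      IsGivenBy Λ φ (fun x => (U x).map f) (fun y => (V y).map g) := by
  simp only [IsGivenBy, State.comp_apply, MaxTensorProduct.map_maxTmul, map_mul, map_star,
    Matrix.map_apply]

/-- Universality sends the generators to the entries of `U` and `V`. The pulled back state therefore
has the same values on all elementary tensors in the formula. -/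
theorem exists_isGivenBy_brownMatrix {m n : ℕ} {A B : Type*} [CStarAlgebra A] [CStarAlgebra B]
    {Λ : ChannelFamily m n} {φ : State (MaxTensorProduct A B)}
    {U : Fin m → Matrix (Fin n) (Fin n) A} {V : Fin m → Matrix (Fin n) (Fin n) B}
    (hU : ∀ x, U x ∈ unitary (Matrix (Fin n) (Fin n) A))
    (hV : ∀ y, V y ∈ unitary (Matrix (Fin n) (Fin n) B)) (h : IsGivenBy Λ φ U V) :
    ∃ φ : State (MaxTensorProduct (BrownFreeProduct m n) (BrownFreeProduct m n)),
      IsGivenBy Λ φ brownMatrix brownMatrix := by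
  refine ⟨φ.comp (MaxTensorProduct.map (BrownFreeProduct.lift U hU) (BrownFreeProduct.lift V hV)),
    (isGivenBy_comp_map ..).mpr ?_⟩
  convert h using 1
  · ext x i j
    exact BrownFreeProduct.lift_brownMatrix U hU x i j
  · ext x i j
    exact BrownFreeProduct.lift_brownMatrix V hV x i j

/-! ### Universe lifts of C*-algebras -/

section ULift

variable {A : Type v} [CStarAlgebra A]

/-- The universal algebras live in the lowest universe, while `H`, `A` and `B` range over arbitrary
ones; lifting transports states and matrices between them. -/
instance ULift.instStarRing : StarRing (ULift.{u} A) where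
  star a := ⟨star a.down⟩
  star_involutive a := congrArg ULift.up (star_star a.down)
  star_mul a b := congrArg ULift.up (star_mul a.down b.down)
  star_add a b := congrArg ULift.up (star_add a.down b.down)

noncomputable instance ULift.instCStarAlgebra : CStarAlgebra (ULift.{u} A) where
  norm_mul_self_le a := CStarRing.norm_mul_self_le a.down
  star_smul c a := congrArg ULift.up (star_smul c a.down)

/-- The canonical *-isomorphism, as a *-homomorphism from the lift. -/
noncomputable def ULift.downStarAlgHom : ULift.{u} A →⋆ₐ[ℂ] A :=
  { (ULift.algEquiv : ULift.{u} A ≃ₐ[ℂ] A).toAlgHom with map_star' := fun _ => rfl }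

/-- The canonical *-isomorphism, as a *-homomorphism to the lift. -/
noncomputable def ULift.upStarAlgHom : A →⋆ₐ[ℂ] ULift.{u} A :=
  { (ULift.algEquiv : ULift.{u} A ≃ₐ[ℂ] A).symm.toAlgHom with map_star' := fun _ => rfl }

end ULift

/-! ### Vector states -/

section Representation

open scoped InnerProductSpace

/-- The vector state on `B(H)` defined by a unit vector. -/
noncomputable def vectorState {H : Type*} [NormedAddCommGroup H] [InnerProductSpace ℂ H]
    [CompleteSpace H] (ζ : H) (hζ : ⟪ζ, ζ⟫_ℂ = 1) : State (H →L[ℂ] H) where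
  toFun T := ⟪ζ, T ζ⟫_ℂ
  map_add' S T := by simp
  map_smul' c T := by simp
  map_one' := by simpa using hζ
  nonneg' T := by
    rw [mul_apply_eq_comp, ContinuousLinearMap.star_eq_adjoint,
      ContinuousLinearMap.adjoint_inner_right, inner_self_eq_norm_sq_to_K]
    exact Complex.zero_le_real.mpr (sq_nonneg ‖T ζ‖) |>.trans_eq (Complex.ofReal_pow _ _)

/-- Every state on a C*-algebra is the pullback of a vector state under a representation. -/
theorem State.exists_representation {A : Type u} [CStarAlgebra A] (φ : State A) :
    ∃ (H : Type u) (_ : NormedAddCommGroup H) (_ : InnerProductSpace ℂ H) (_ : CompleteSpace H)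
      (π : A →⋆ₐ[ℂ] (H →L[ℂ] H)) (ψ : State (H →L[ℂ] H)), ∀ a, ψ (π a) = φ a := by
  let _ : PartialOrder A := CStarAlgebra.spectralOrder A
  let _ : StarOrderedRing A := CStarAlgebra.spectralOrderedRing A
  let f : A →ₚ[ℂ] ℂ := PositiveLinearMap.mk₀ φ.toLinearMap fun a ha => by
    -- Positive elements are exactly the `b* b`, so algebraic positivity of `φ` is order positivity.
    obtain ⟨b, rfl⟩ := CStarAlgebra.nonneg_iff_eq_star_mul_self.mp ha
    exact φ.nonneg' b
  -- The class of the unit: the GNS inner product gives `⟪ζ, π(a) ζ⟫ = φ(1* a 1)`.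
  let ζ : f.GNS := (f.toPreGNS 1 : f.PreGNS)
  have h : ∀ a, ⟪ζ, f.gnsStarAlgHom a ζ⟫_ℂ = φ a := fun a => by
    change ⟪ζ, f.gnsNonUnitalStarAlgHom a ζ⟫_ℂ = φ a
    rw [PositiveLinearMap.gnsNonUnitalStarAlgHom_apply_coe, UniformSpace.Completion.inner_coe,
      PositiveLinearMap.preGNS_inner_def, PositiveLinearMap.leftMulMapPreGNS_apply]
    simp only [PositiveLinearMap.ofPreGNS_toPreGNS, star_one, one_mul]
    simp
    rfl
  have hζ : ⟪ζ, ζ⟫_ℂ = 1 := by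
    have h1 := h 1
    rw [map_one, one_apply_eq_self] at h1
    exact h1.trans φ.map_one'
  exact ⟨f.GNS, inferInstance, inferInstance, inferInstance, f.gnsStarAlgHom,
    vectorState ζ hζ, h⟩

end Representation

/-! ### Operators of Alice and Bob -/

section Channels

variable {n : ℕ} {C : Type*} [Ring C] [Algebra ℂ C]

/-- The map `V ↦ 1 ⊗ V`, as a homomorphism of algebras. -/
noncomputable def bobHom (n : ℕ) (C : Type*) [Ring C] [Algebra ℂ C] :
    Matrix (Fin n) (Fin n) C →ₐ[ℂ] (Mat n ⊗[ℂ] C) ⊗[ℂ] Mat n :=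
  (Algebra.TensorProduct.map (Algebra.TensorProduct.includeRight : C →ₐ[ℂ] Mat n ⊗[ℂ] C)
    (AlgHom.id ℂ (Mat n))).comp (matrixEquivTensor (Fin n) ℂ C).toAlgHom

/-- Makes `bobOp` multiplicative and unital, so that it preserves inverses. -/
theorem bobHom_apply (V : Matrix (Fin n) (Fin n) C) : bobHom n C V = bobOp V := by
  change Algebra.TensorProduct.map _ _ (matrixEquivTensor (Fin n) ℂ C V) = _
  rw [matrixEquivTensor_apply, map_sum, ← Finset.univ_product_univ, Finset.sum_product]
  rfl

/-- The coefficient in `C` of an element of `Mₙ ⊗ C ⊗ Mₙ` at a pair of matrix units. -/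
noncomputable def matCoeff (i j k l : Fin n) : ((Mat n ⊗[ℂ] C) ⊗[ℂ] Mat n) →ₗ[ℂ] C :=
  (TensorProduct.rid ℂ C).toLinearMap ∘ₗ TensorProduct.map
    ((TensorProduct.lid ℂ C).toLinearMap ∘ₗ
      TensorProduct.map (Matrix.entryLinearMap ℂ ℂ i j) LinearMap.id)
    (Matrix.entryLinearMap ℂ ℂ k l)

theorem matCoeff_tmul (i j k l : Fin n) (a : Mat n) (c : C) (b : Mat n) :
    matCoeff i j k l ((a ⊗ₜ c) ⊗ₜ b) = b k l • a i j • c := rfl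

theorem map_sum_mul_sum {R M ι : Type*} [Ring R] [AddCommMonoid M] [Fintype ι] (f : R →+ M)
    (a b : ι → ι → R) : f ((∑ i, ∑ j, a i j) * ∑ k, ∑ l, b k l) =
      ∑ i, ∑ j, ∑ k, ∑ l, f (a i j * b k l) := by
  simp only [Finset.sum_mul]
  simp only [Finset.mul_sum, map_sum]

theorem commute_sum_sum {R ι : Type*} [Ring R] [Fintype ι] {a b : ι → ι → R}
    (h : ∀ i j k l, Commute (a i j) (b k l)) : Commute (∑ i, ∑ j, a i j) (∑ k, ∑ l, b k l) :=
  Commute.sum_left _ _ _ fun i _ => Commute.sum_left _ _ _ fun j _ =>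
    Commute.sum_right _ _ _ fun k _ => Commute.sum_right _ _ _ fun l _ => h i j k l

/-- The outer factors are summed over `i j k l` and the inner ones over `p r s t`, matching the
order of summation in `IsGivenBy`. -/
theorem map_sum_conj_conj {R M ι : Type*} [Ring R] [AddCommMonoid M] [Fintype ι] (f : R →+ M)
    (a b c d : ι → ι → R) (z : R) :
    f ((∑ i, ∑ j, a i j) * (∑ p, ∑ r, b p r) * z * (∑ s, ∑ t, c s t) * ∑ k, ∑ l, d k l) =
      ∑ i, ∑ j, ∑ k, ∑ l, ∑ p, ∑ r, ∑ s, ∑ t, f (a i j * (b p r * z * c s t) * d k l) := by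
  have h : (∑ p, ∑ r, b p r) * z * (∑ s, ∑ t, c s t) =
      ∑ p, ∑ r, ∑ s, ∑ t, b p r * z * c s t := by
    simp only [Finset.sum_mul]
    simp only [Finset.mul_sum]
  rw [mul_assoc (∑ i, ∑ j, a i j), mul_assoc (∑ i, ∑ j, a i j), h]
  rw [Finset.sum_mul, Finset.sum_mul, map_sum]
  simp only [Finset.sum_mul, map_sum]
  simp only [Finset.mul_sum, map_sum]
  simp only [Finset.sum_mul, map_sum]

theorem commute_of_mul_eq_one {R : Type*} [Ring R] {a b c : R} (h : Commute a b) (hbc : b * c = 1)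
    (hcb : c * b = 1) : Commute a c :=
  Commute.units_inv_right (u := ⟨b, c, hbc, hcb⟩) h

theorem aliceOp_eq_sum (U : Matrix (Fin n) (Fin n) C) :
    aliceOp U = ∑ i, ∑ j, (matUnit i j ⊗ₜ[ℂ] U i j) ⊗ₜ[ℂ] (1 : Mat n) := by
  simp only [aliceOp, TensorProduct.sum_tmul]

/-- The matrix units of Alice and Bob sit in different tensor factors, so a single term survives.
With the reversed product below, it reads off entrywise commutation. -/
theorem matCoeff_aliceOp_mul_bobOp (U V : Matrix (Fin n) (Fin n) C) (i j k l : Fin n) :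
    matCoeff i j k l (aliceOp U * bobOp V) = U i j * V k l := by
  rw [aliceOp_eq_sum]
  refine (map_sum_mul_sum (R := (Mat n ⊗[ℂ] C) ⊗[ℂ] Mat n) (M := C)
    (ι := Fin n) (matCoeff i j k l).toAddMonoidHom _ _).trans ?_
  simp only [LinearMap.toAddMonoidHom_coe, Algebra.TensorProduct.tmul_mul_tmul, one_mul, mul_one,
    matCoeff_tmul]
  simp [Matrix.single_apply, ite_and]

theorem matCoeff_bobOp_mul_aliceOp (U V : Matrix (Fin n) (Fin n) C) (i j k l : Fin n) :
    matCoeff i j k l (bobOp V * aliceOp U) = V k l * U i j := by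
  rw [aliceOp_eq_sum]
  refine (map_sum_mul_sum (R := (Mat n ⊗[ℂ] C) ⊗[ℂ] Mat n) (M := C)
    (ι := Fin n) (matCoeff i j k l).toAddMonoidHom _ _).trans ?_
  simp only [LinearMap.toAddMonoidHom_coe, Algebra.TensorProduct.tmul_mul_tmul, one_mul, mul_one,
    matCoeff_tmul]
  simp [Matrix.single_apply, ite_and]

theorem commute_of_commute_aliceOp_bobOp {U V : Matrix (Fin n) (Fin n) C}
    (h : Commute (aliceOp U) (bobOp V)) (i j k l : Fin n) : Commute (U i j) (V k l) := by
  rw [Commute, SemiconjBy, ← matCoeff_aliceOp_mul_bobOp, h.eq, matCoeff_bobOp_mul_aliceOp]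

/-- By unitarity, `bobOp (star V)` is the inverse of `bobOp V`, and whatever commutes with an
invertible element commutes with its inverse. This supplies commutation with adjoints, which the
definition of the model does not state. -/
theorem commute_aliceOp_bobOp_star [StarRing C] {U V : Matrix (Fin n) (Fin n) C}
    (hV : V ∈ unitary (Matrix (Fin n) (Fin n) C)) (h : Commute (aliceOp U) (bobOp V)) :
    Commute (aliceOp U) (bobOp (star V)) := by
  refine commute_of_mul_eq_one (R := (Mat n ⊗[ℂ] C) ⊗[ℂ] Mat n) h ?_ ?_
  · rw [← bobHom_apply, ← bobHom_apply, ← map_mul, (Unitary.mem_iff.mp hV).2]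
    exact (bobHom n C).map_one
  · rw [← bobHom_apply, ← bobHom_apply, ← map_mul, (Unitary.mem_iff.mp hV).1]
    exact (bobHom n C).map_one

theorem commute_aliceOp_bobOp {U V : Matrix (Fin n) (Fin n) C}
    (h : ∀ i j k l, Commute (U i j) (V k l)) : Commute (aliceOp U) (bobOp V) := by
  rw [aliceOp_eq_sum]
  refine commute_sum_sum (R := (Mat n ⊗[ℂ] C) ⊗[ℂ] Mat n) (ι := Fin n) fun i j k l => ?_
  rw [Commute, SemiconjBy]
  simp only [Algebra.TensorProduct.tmul_mul_tmul, one_mul, mul_one, (h i j k l).eq]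

theorem productFunctional_conj [StarRing C] (φ' : (Mat n ⊗[ℂ] Mat n) →ₗ[ℂ] ℂ) (φ : C →ₗ[ℂ] ℂ)
    {U V : Matrix (Fin n) (Fin n) C} (hUV : ∀ i j k l, Commute (U i j) (V k l))
    (hUV' : ∀ i j k l, Commute (U i j) (star (V k l))) (g h : Mat n) :
    productFunctional φ' φ (aliceOp U * bobOp V * ((g ⊗ₜ 1) ⊗ₜ h) *
        bobOp (star V) * aliceOp (star U)) =
      ∑ i, ∑ j, ∑ k, ∑ l, ∑ p, ∑ r, ∑ s, ∑ t,
        φ' ((matUnit i j * g * matUnit k l) ⊗ₜ (matUnit p r * h * matUnit s t)) *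
          φ (U i j * star (U l k) * (V p r * star (V t s))) := by
  rw [aliceOp_eq_sum, aliceOp_eq_sum]
  refine (map_sum_conj_conj (R := (Mat n ⊗[ℂ] C) ⊗[ℂ] Mat n) (M := ℂ)
    (ι := Fin n) (productFunctional φ' φ).toAddMonoidHom _ _ _ _ _).trans ?_
  refine Finset.sum_congr rfl fun i _ => Finset.sum_congr rfl fun j _ =>
    Finset.sum_congr rfl fun k _ => Finset.sum_congr rfl fun l _ =>
    Finset.sum_congr rfl fun p _ => Finset.sum_congr rfl fun r _ =>
    Finset.sum_congr rfl fun s _ => Finset.sum_congr rfl fun t _ => ?_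
  -- In the product, `(Uₗₖ)*` stands to the right of Bob's entries and must be moved past them; the
  -- needed relations are the adjoints of `hUV'` and `hUV`.
  have h1 : Commute (star (U l k)) (V p r * star (V t s)) := by
    have h2 : Commute (star (U l k)) (V p r) := by
      simpa using (hUV' l k p r).star_star
    exact h2.mul_right (hUV l k t s).star_star
  simp only [LinearMap.toAddMonoidHom_coe, Algebra.TensorProduct.tmul_mul_tmul, one_mul, mul_one,
    productFunctional_tmul, Matrix.star_apply]
  rw [mul_assoc (U i j), mul_assoc (U i j), h1.eq]

end Channels

/-! ### Between commuting operators and the maximal tensor product -/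

theorem Matrix.mem_unitary_of_map {n : Type*} [Fintype n] [DecidableEq n] {A B : Type*} [Ring A]
    [StarRing A] [Algebra ℂ A] [Ring B] [StarRing B] [Algebra ℂ B] (f : A →⋆ₐ[ℂ] B)
    (hf : Function.Injective f) {U : Matrix n n A} (hU : U.map f ∈ unitary (Matrix n n B)) :
    U ∈ unitary (Matrix n n A) := by
  have hs : star (U.map f) = (star U).map f := by
    ext i j
    exact (map_star f (U j i)).symm
  have h1 : (1 : Matrix n n A).map f = 1 := Matrix.map_one f (map_zero f) (map_one f)
  rw [Unitary.mem_iff, hs, ← Matrix.map_mul, ← Matrix.map_mul, ← h1] at hU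
  exact ⟨Matrix.map_injective hf hU.1, Matrix.map_injective hf hU.2⟩

/-- Matrices with commuting entries in a C*-algebra `C` and a state on `C` define a state on the
maximal tensor product of two commuting C*-subalgebras. -/
theorem exists_isGivenBy_of_commute {m n : ℕ} {C : Type*} [CStarAlgebra C] {Λ : ChannelFamily m n}
    (φ : State C) {U V : Fin m → Matrix (Fin n) (Fin n) C}
    (hU : ∀ x, U x ∈ unitary (Matrix (Fin n) (Fin n) C))
    (hV : ∀ y, V y ∈ unitary (Matrix (Fin n) (Fin n) C))
    (hUV : ∀ x y i j k l, Commute (U x i j) (V y k l))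
    (hUV' : ∀ x y i j k l, Commute (U x i j) (star (V y k l)))
    (h : ∀ (x y : Fin m) (φ' : State (Mat n ⊗[ℂ] Mat n)) (g h : Mat n),
      Λ x y φ' (g ⊗ₜ h) = ∑ i, ∑ j, ∑ k, ∑ l, ∑ p, ∑ r, ∑ s, ∑ t,
        φ' ((matUnit i j * g * matUnit k l) ⊗ₜ (matUnit p r * h * matUnit s t)) *
          φ (U x i j * star (U x l k) * (V y p r * star (V y t s)))) :
    ∃ φ : State (MaxTensorProduct (BrownFreeProduct m n) (BrownFreeProduct m n)),
      IsGivenBy Λ φ brownMatrix brownMatrix := by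
  let S : Set C := {c | ∃ y k l, c = V y k l}
  -- `N` is the commutant of Bob's entries and their adjoints, `N'` its own commutant. Then `N`
  -- contains Alice's entries, `N'` contains Bob's, and the two commute by construction, with no
  -- density argument on generated subalgebras. Being closed, both are C*-algebras.
  let N : StarSubalgebra ℂ C := StarSubalgebra.centralizer ℂ S
  let N' : StarSubalgebra ℂ C := StarSubalgebra.centralizer ℂ (N : Set C)
  have : IsClosed (N : Set C) := Set.isClosed_centralizer _
  have : IsClosed (N' : Set C) := Set.isClosed_centralizer _
  have hUN : ∀ x i j, U x i j ∈ N := fun x i j => by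
    rw [StarSubalgebra.mem_centralizer_iff]
    rintro _ ⟨y, k, l, rfl⟩
    exact ⟨(hUV x y i j k l).symm.eq, (hUV' x y i j k l).symm.eq⟩
  have hVN : ∀ y k l, V y k l ∈ N' := fun y k l => by
    rw [StarSubalgebra.mem_centralizer_iff]
    intro a ha
    have hc : ∀ b ∈ N, b * V y k l = V y k l * b := fun b hb =>
      ((StarSubalgebra.mem_centralizer_iff ℂ).mp hb _ ⟨y, k, l, rfl⟩).1.symm
    exact ⟨hc a ha, hc _ (star_mem ha)⟩
  have hc : ∀ (a : N) (b : N'), Commute (N.subtype a) (N'.subtype b) := fun a b =>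
    ((StarSubalgebra.mem_centralizer_iff ℂ).mp b.2 _ a.2).1
  let U' : Fin m → Matrix (Fin n) (Fin n) N := fun x => Matrix.of fun i j => ⟨U x i j, hUN x i j⟩
  let V' : Fin m → Matrix (Fin n) (Fin n) N' := fun y => Matrix.of fun i j => ⟨V y i j, hVN y i j⟩
  refine exists_isGivenBy_brownMatrix (U := U') (V := V')
    (φ := φ.comp (MaxTensorProduct.lift N.subtype N'.subtype hc))
    (fun x => Matrix.mem_unitary_of_map N.subtype Subtype.val_injective (hU x))
    (fun y => Matrix.mem_unitary_of_map N'.subtype Subtype.val_injective (hV y)) ?_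
  intro x y φ' g g'
  rw [h]
  simp only [State.comp_apply, MaxTensorProduct.lift_maxTmul]
  rfl

theorem Lqc.exists_isGivenBy {m n : ℕ} {Λ : ChannelFamily m n} (h : Λ ∈ Lqc.{u} m n) :
    ∃ φ : State (MaxTensorProduct (BrownFreeProduct m n) (BrownFreeProduct m n)),
      IsGivenBy Λ φ brownMatrix brownMatrix := by
  obtain ⟨H, _, _, _, φ, U, V, hU, hV, hc, hΛ⟩ := h
  have hc' : ∀ x y, Commute (aliceOp (U x)) (bobOp (star (V y))) := fun x y =>
    commute_aliceOp_bobOp_star (hV y) (hc x y)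
  have hUV : ∀ x y i j k l, Commute (U x i j) (V y k l) := fun x y =>
    commute_of_commute_aliceOp_bobOp (hc x y)
  have hUV' : ∀ x y i j k l, Commute (U x i j) (star (V y k l)) := fun x y i j k l =>
    -- The indices are swapped because the `(l, k)` entry of `V*` is `(Vₖₗ)*`.
    commute_of_commute_aliceOp_bobOp (hc' x y) i j l k
  refine exists_isGivenBy_of_commute φ hU hV hUV hUV' fun x y φ' g h => ?_
  rw [hΛ, productFunctional_conj _ _ (hUV x y) (hUV' x y)]

/-- The operators are the images under `π` of the entries in `A ⊗ 1` and `1 ⊗ B`. These legs commute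
as *-algebras, so commutation with adjoints is automatic. -/
theorem IsGivenBy.mem_Lqc_of_representation {m n : ℕ} {A B : Type*} [CStarAlgebra A]
    [CStarAlgebra B] {Λ : ChannelFamily m n} {φ : State (MaxTensorProduct A B)}
    {U : Fin m → Matrix (Fin n) (Fin n) A} {V : Fin m → Matrix (Fin n) (Fin n) B}
    (hU : ∀ x, U x ∈ unitary (Matrix (Fin n) (Fin n) A))
    (hV : ∀ y, V y ∈ unitary (Matrix (Fin n) (Fin n) B)) (h : IsGivenBy Λ φ U V)
    {H : Type u} [NormedAddCommGroup H] [InnerProductSpace ℂ H] [CompleteSpace H]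
    (π : MaxTensorProduct A B →⋆ₐ[ℂ] (H →L[ℂ] H)) (ψ : State (H →L[ℂ] H))
    (hψ : ∀ a, ψ (π a) = φ a) : Λ ∈ Lqc.{u} m n := by
  let f : A →⋆ₐ[ℂ] (H →L[ℂ] H) := π.comp MaxTensorProduct.inl
  let f' : B →⋆ₐ[ℂ] (H →L[ℂ] H) := π.comp MaxTensorProduct.inr
  have hc : ∀ a b, Commute (f a) (f' b) := fun a b =>
    (MaxTensorProduct.commute_inl_inr a b).map π
  have hUV : ∀ x y i j k l, Commute ((U x).map f i j) ((V y).map f' k l) :=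
    fun x y i j k l => hc _ _
  have hUV' : ∀ x y i j k l, Commute ((U x).map f i j) (star ((V y).map f' k l)) :=
    fun x y i j k l => by
      rw [Matrix.map_apply, Matrix.map_apply, ← map_star]
      exact hc _ _
  refine ⟨H, inferInstance, inferInstance, inferInstance, ψ, fun x => (U x).map f,
    fun y => (V y).map f', fun x => Matrix.map_mem_unitary f (hU x),
    fun y => Matrix.map_mem_unitary f' (hV y), fun x y => commute_aliceOp_bobOp (hUV x y),
    fun x y φ' g g' => ?_⟩
  rw [productFunctional_conj _ _ (hUV x y) (hUV' x y), h]
  simp only [Matrix.map_apply, ← map_star, ← map_mul]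
  have e : ∀ a b, φ (maxTmul a b) = ψ (f a * f' b) := fun a b => by
    rw [← hψ, ← MaxTensorProduct.inl_mul_inr, map_mul]
    rfl
  simp only [e]

theorem mainTheorem5 (m n : ℕ) (Λ : ChannelFamily m n) :
    List.TFAE [
      Λ ∈ Lqc.{u} m n,
      ∃ (A : Type v) (B : Type w) (_ : CStarAlgebra A) (_ : CStarAlgebra B)
        (φ : State (MaxTensorProduct A B))
        (U : Fin m → Matrix (Fin n) (Fin n) A) (V : Fin m → Matrix (Fin n) (Fin n) B),
        (∀ x, U x ∈ unitary (Matrix (Fin n) (Fin n) A)) ∧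
        (∀ y, V y ∈ unitary (Matrix (Fin n) (Fin n) B)) ∧
        IsGivenBy Λ φ U V,
      ∃ φ : State (MaxTensorProduct (BrownFreeProduct m n) (BrownFreeProduct m n)),
        IsGivenBy Λ φ brownMatrix brownMatrix] := by
  tfae_have 1 → 3 := Lqc.exists_isGivenBy
  tfae_have 2 → 3 := by
    rintro ⟨A, B, _, _, φ, U, V, hU, hV, h⟩
    exact exists_isGivenBy_brownMatrix hU hV h
  tfae_have 3 → 1 := by
    rintro ⟨φ, h⟩
    -- The GNS space lies in the universe of the algebra, so lifting the algebra first puts `H` in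
    -- `Type u`.
    obtain ⟨H, _, _, _, π, ψ, hψ⟩ := State.exists_representation (φ.comp ULift.downStarAlgHom.{u})
    exact h.mem_Lqc_of_representation brownMatrix_mem_unitary brownMatrix_mem_unitary
      (π.comp ULift.upStarAlgHom) ψ fun a => hψ _
  tfae_have 3 → 2 := by
    rintro ⟨φ, h⟩
    refine ⟨ULift.{v} (BrownFreeProduct m n), ULift.{w} (BrownFreeProduct m n), inferInstance,
      inferInstance, φ.comp (MaxTensorProduct.map ULift.downStarAlgHom ULift.downStarAlgHom),
      fun x => (brownMatrix x).map ULift.upStarAlgHom,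
      fun y => (brownMatrix y).map ULift.upStarAlgHom,
      fun x => Matrix.map_mem_unitary _ (brownMatrix_mem_unitary x),
      fun y => Matrix.map_mem_unitary _ (brownMatrix_mem_unitary y), ?_⟩
    rw [isGivenBy_comp_map]
    exact h
  tfae_finish
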